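/- Let $m,n,k\ge 0$ be integers, let $S^p\subset\mathbb R^{p+1}$ be the unit sphere with its standard metric, and call a map $\mathbb R^p\to\mathbb R^q$ a form of degree $k$ if each of its components is a homogeneous polynomial of degree $k$ (possibly zero). Let $G:\mathbb R^{m+1}\to\mathbb R^{n+1}$ be a harmonic form of degree $k$, that is, a form of degree $k$ with vanishing Laplacian, which maps $S^m$ into $S^n$ and whose restriction $\psi:S^m\to S^n$ is not constant. Define $F:\mathbb R^{m+1}\to\mathbb R^{(m+1)(n+1)}$ by $$F(x)=\bigl(x^1G(x),\,x^2G(x),\,\dots,\,x^{m+1}G(x)\bigr).$$ Then $F$ is a form of degree $k+1$, it maps $S^m$ into $S^{(m+1)(n+1)-1}$, and its restriction $\varphi:S^m\to S^{(m+1)(n+1)-1}$ is proper biharmonic if and only if $m=1$. Here, for a smooth map $\varphi:M\to N$ between Riemannian manifolds, $\tau(\varphi)=\operatorname{trace}\nabla d\varphi$ is the tension field and $\tau_2(\varphi)=-\Delta\tau(\varphi)-\operatorname{trace}R^N(d\varphi(\cdot),\tau(\varphi))\,d\varphi(\cdot)$ the bitension field, where $\Delta\sigma=-\operatorname{trace}\nabla^2\sigma$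 on sections of $\varphi^{-1}TN$ and $R(X,Y)Z=\nabla_X\nabla_YZ-\nabla_Y\nabla_XZ-\nabla_{[X,Y]}Z$. The map $\varphi$ is harmonic if $\tau(\varphi)=0$, biharmonic if $\tau_2(\varphi)=0$, and proper biharmonic if it is biharmonic but not harmonic. -/

import Mathlib

open scoped Manifold ContDiff

noncomputable section

namespace SphereMap

/-- The unit sphere of a real inner product space. -/
abbrev UnitSphere (E : Type*) [NormedAddCommGroup E] [InnerProductSpace ℝ E] : Type _ :=
  Metric.sphere (0 : E) 1

section Calculus

variable {E : Type*} [NormedAddCommGroup E] [InnerProductSpace ℝ E]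
variable {V : Type*} [NormedAddCommGroup V] [InnerProductSpace ℝ V]

/-- The radial projection `y ↦ y / ‖y‖` of a nonzero vector to the unit sphere. -/
def radialProj (y : E) (hy : y ≠ 0) : UnitSphere E :=
  ⟨‖y‖⁻¹ • y, by simp [norm_smul, hy]⟩

open Classical in
/-- The extension of a vector-valued function on the unit sphere which is constant along the
open rays from the origin (with the irrelevant value `0` at the origin). -/
def radialExt (f : UnitSphere E → V) (y : E) : V :=
  if hy : y = 0 then 0 else f (radialProj y hy)

/-- The differential `df_x(v)` of a function `f` on the unit sphere with values in a vector
space, at the point `x` and in the direction of a tangent vector `v ⟂ x`.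
(Any smooth extension gives the same value on tangent vectors; with the radial one, the
component of `v` along `x` is ignored.) -/
def sphDeriv (f : UnitSphere E → V) (x : UnitSphere E) (v : E) : V :=
  fderiv ℝ (radialExt f) (x : E) v

/-- The tangent space at `x` of the unit sphere, as the subspace `x^⟂` of the ambient space. -/
abbrev tangentSpace (x : UnitSphere E) : Submodule ℝ E := (ℝ ∙ (x : E))ᗮ

/-- The orthogonal projection of the ambient space onto the tangent space at `x`. -/
def tangentProj (x : UnitSphere E) (w : E) : E :=
  (tangentSpace x).starProjection w

/-- The tangent vector field on the sphere obtained by projecting the constant field `w`.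
At a point `x` with `w ⟂ x` its value is `w`: it is a smooth extension of the tangent vector
`w` to a tangent vector field. -/
def tangentField (w : E) : UnitSphere E → E := fun y => tangentProj y w

/-- The differential `dφ_x(v)` of a map between unit spheres, as a vector of the ambient space
of the target. -/
def differential (φ : UnitSphere E → UnitSphere V) (x : UnitSphere E) (v : E) : V :=
  sphDeriv (fun y => (φ y : V)) x v

/-- The covariant derivative `(∇_v Y)(x)` of a tangent vector field `Y` for the Levi-Civita
connection of the unit sphere with the metric induced by the ambient space: the tangential
part of the ambient derivative. -/
def leviCivita (Y : UnitSphere E → E) (x : UnitSphere E) (v : E) : E :=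
  tangentProj x (sphDeriv Y x v)

/-- The connection `∇^φ` induced on the pull-back bundle `φ⁻¹TS` of the tangent bundle of the
target sphere `S`; a section is a map `σ` with `σ x` tangent to `S` at `φ x`. -/
def pullbackConn (φ : UnitSphere E → UnitSphere V) (σ : UnitSphere E → V)
    (x : UnitSphere E) (v : E) : V :=
  tangentProj (φ x) (sphDeriv σ x v)

/-- The curvature tensor `R(u,v)w = ∇_u ∇_v w - ∇_v ∇_u w - ∇_[u,v] w` of the unit sphere at `y`,
computed with the extensions of the tangent vectors `u, v, w` by `tangentField`;
the Lie bracket is `[X, Y] = ∇_X Y - ∇_Y X`. -/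
def curvature (y : UnitSphere V) (u v w : V) : V :=
  leviCivita (fun z => leviCivita (tangentField w) z (tangentField v z)) y u
    - leviCivita (fun z => leviCivita (tangentField w) z (tangentField u z)) y v
    - leviCivita (tangentField w) y
        (leviCivita (tangentField v) y u - leviCivita (tangentField u) y v)

/-- `(∇dφ)(v, w) = ∇^φ_v (dφ(w)) - dφ(∇_v w)`, for `v`, `w` tangent at `x`. -/
def covDerivDifferential (φ : UnitSphere E → UnitSphere V) (x : UnitSphere E) (v w : E) : V :=
  pullbackConn φ (fun y => differential φ y (tangentField w y)) x v
    - differential φ x (leviCivita (tangentField w) x v)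

/-- `(∇²σ)(v, w) = ∇^φ_v ∇^φ_w σ - ∇^φ_{∇_v w} σ`, for `v`, `w` tangent at `x` and a section `σ`
of the pull-back bundle. -/
def secondCovDeriv (φ : UnitSphere E → UnitSphere V) (σ : UnitSphere E → V)
    (x : UnitSphere E) (v w : E) : V :=
  pullbackConn φ (fun y => pullbackConn φ σ y (tangentField w y)) x v
    - pullbackConn φ σ x (leviCivita (tangentField w) x v)

variable [FiniteDimensional ℝ E]

/-- The trace over the tangent space at `x` of a bilinear expression `B`. -/
def tangentTrace (x : UnitSphere E) (B : E → E → V) : V :=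
  ∑ i, B (stdOrthonormalBasis ℝ (tangentSpace x) i) (stdOrthonormalBasis ℝ (tangentSpace x) i)

/-- The tension field `τ(φ) = trace ∇dφ`. -/
def tensionField (φ : UnitSphere E → UnitSphere V) (x : UnitSphere E) : V :=
  tangentTrace x (covDerivDifferential φ x)

/-- The rough Laplacian `Δσ = - trace ∇²σ` on sections of the pull-back bundle. -/
def roughLaplacian (φ : UnitSphere E → UnitSphere V) (σ : UnitSphere E → V)
    (x : UnitSphere E) : V :=
  - tangentTrace x (secondCovDeriv φ σ x)

/-- The bitension field `τ₂(φ) = - Δ τ(φ) - trace R(dφ(·), τ(φ)) dφ(·)`, with the curvature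
tensor `R` of the target sphere. -/
def bitensionField (φ : UnitSphere E → UnitSphere V) (x : UnitSphere E) : V :=
  - roughLaplacian φ (tensionField φ) x
    - tangentTrace x (fun v w =>
        curvature (φ x) (differential φ x v) (tensionField φ x) (differential φ x w))

end Calculus

section Maps

variable {m : ℕ} {V : Type*} [NormedAddCommGroup V] [InnerProductSpace ℝ V]

/-- Smoothness of a map from `S^m` to a unit sphere, as a map into the ambient space of the
target, in which the target sphere is an embedded submanifold. -/
def IsSmooth (φ : UnitSphere (EuclideanSpace ℝ (Fin (m + 1))) → UnitSphere V) : Prop :=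
  ContMDiff (𝓡 m) 𝓘(ℝ, V) ∞ (fun x => (φ x : V))

/-- Harmonic maps: the smooth maps with vanishing tension field. -/
def IsHarmonicMap (φ : UnitSphere (EuclideanSpace ℝ (Fin (m + 1))) → UnitSphere V) : Prop :=
  IsSmooth φ ∧ ∀ x, tensionField φ x = 0

/-- Biharmonic maps: the smooth maps with vanishing bitension field. -/
def IsBiharmonicMap (φ : UnitSphere (EuclideanSpace ℝ (Fin (m + 1))) → UnitSphere V) : Prop :=
  IsSmooth φ ∧ ∀ x, bitensionField φ x = 0

/-- Proper biharmonic maps: biharmonic and not harmonic. -/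
def IsProperBiharmonicMap
    (φ : UnitSphere (EuclideanSpace ℝ (Fin (m + 1))) → UnitSphere V) : Prop :=
  IsBiharmonicMap φ ∧ ¬ IsHarmonicMap φ

end Maps

/-- A form of degree `k`: a map `ℝ^p → ℝ^q` whose components are homogeneous polynomials of
degree `k` (the zero polynomial being allowed). -/
def IsForm {p q : ℕ} (k : ℕ) (G : EuclideanSpace ℝ (Fin p) → EuclideanSpace ℝ (Fin q)) : Prop :=
  ∀ j, ∃ P : MvPolynomial (Fin p) ℝ, P.IsHomogeneous k ∧ ∀ x, G x j = MvPolynomial.eval x.ofLp P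

/-- A harmonic form of degree `k`. -/
def IsHarmonicForm {p q : ℕ} (k : ℕ)
    (G : EuclideanSpace ℝ (Fin p) → EuclideanSpace ℝ (Fin q)) : Prop :=
  IsForm k G ∧ InnerProductSpace.HarmonicOnNhd G Set.univ

/-- The map `x ↦ (x¹ G(x), x² G(x), …, x^p G(x))` from `ℝ^p` to `ℝ^(p * q)`, made of `p` consecutive
blocks of length `q`. -/
def blockForm {p q : ℕ} (G : EuclideanSpace ℝ (Fin p) → EuclideanSpace ℝ (Fin q))
    (x : EuclideanSpace ℝ (Fin p)) : EuclideanSpace ℝ (Fin (p * q)) :=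
  WithLp.toLp 2 fun a => x (finProdFinEquiv.symm a).1 * G x (finProdFinEquiv.symm a).2

end SphereMap

end

/-! Write `F x = x ⊗ G x`, the tensor product being a bilinear map `B` with `⟪u ⊗ c, v ⊗ d⟫ = ⟪u, v⟫
⟪c, d⟫`, and let `C = ∑ eᵢ ⊗ ∂ᵢG`. The claim reduces to the identity `τ₂(φ) = 2(m - 1) τ(φ)`
(`bitensionField_bilinear`): for `m ≠ 1` biharmonic forces harmonic, and for `m = 1` every such `φ`
is biharmonic.

For a map between unit spheres extended to `F`, and a field `T` extending the tension field, `τ` is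
the tangential part of `L F` and `τ₂` is the tangential part of `L T` plus `|dφ|² T`, where `L` is
the Laplacian of the domain sphere and `|dφ|² = -⟪F, L F⟫` (`tensionField_eq`, `bitensionField_eq`).
Harmonicity of `G` gives `ΔF = 2C` and `ΔC = 0`; `F` and `C` have degrees `k + 1` and `k - 1`, so
Euler's identity makes `L F` and `L C` combinations of `F` and `C`. Since `⟪F, C⟫ = k` on the
sphere, `τ = 2C - 2kF`, and `τ₂` follows by comparing coefficients.

It remains to exclude `τ = 0` when `m = 1`. Then `L τ = 0` as well, and pairing with `F` gives `4k²
= 0`; but a form of degree zero is constant. -/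

noncomputable section

namespace SphereMap

open scoped RealInnerProductSpace
open InnerProductSpace Laplacian

/-! ### Derivatives, connection and curvature of the unit sphere in ambient terms. -/

section SphereCalculus

variable {E : Type*} [NormedAddCommGroup E] [InnerProductSpace ℝ E]
variable {V : Type*} [NormedAddCommGroup V] [InnerProductSpace ℝ V]

lemma norm_coe (x : UnitSphere E) : ‖(x : E)‖ = 1 := by simp

lemma inner_self_coe (x : UnitSphere E) : ⟪(x : E), (x : E)⟫ = 1 := by
  simp

lemma tangentProj_apply (x : UnitSphere E) (w : E) :
    tangentProj x w = w - ⟪(x : E), w⟫ • (x : E) := by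
  simp [tangentProj, tangentSpace, Submodule.starProjection_orthogonal,
    Submodule.starProjection_unit_singleton]

lemma tangentProj_of_inner_eq_zero {x : UnitSphere E} {w : E} (h : ⟪(x : E), w⟫ = 0) :
    tangentProj x w = w := by
  simp [tangentProj_apply, h]

lemma inner_tangentProj (x : UnitSphere E) (w : E) : ⟪(x : E), tangentProj x w⟫ = 0 := by
  rw [tangentProj_apply, inner_sub_right, inner_smul_right, inner_self_coe]
  ring

lemma tangentProj_tangentProj (x : UnitSphere E) (w : E) :
    tangentProj x (tangentProj x w) = tangentProj x w :=
  tangentProj_of_inner_eq_zero (inner_tangentProj x w)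

lemma tangentProj_add (x : UnitSphere E) (v w : E) :
    tangentProj x (v + w) = tangentProj x v + tangentProj x w := map_add _ _ _

lemma tangentProj_smul (x : UnitSphere E) (c : ℝ) (w : E) :
    tangentProj x (c • w) = c • tangentProj x w := map_smul _ _ _

lemma tangentProj_neg (x : UnitSphere E) (w : E) :
    tangentProj x (-w) = -tangentProj x w := map_neg _ _

lemma tangentProj_sub (x : UnitSphere E) (v w : E) :
    tangentProj x (v - w) = tangentProj x v - tangentProj x w := map_sub _ _ _

lemma tangentProj_self (x : UnitSphere E) : tangentProj x (x : E) = 0 := by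
  rw [tangentProj_apply, inner_self_coe, one_smul, sub_self]

lemma tangentProj_smul_self (x : UnitSphere E) (c : ℝ) : tangentProj x (c • (x : E)) = 0 := by
  rw [tangentProj_smul, tangentProj_self, smul_zero]

/-- The differential of the restriction of a differentiable map to the sphere. -/
theorem sphDeriv_eq {W : Type*} [NormedAddCommGroup W] [InnerProductSpace ℝ W]
    {f : UnitSphere E → W} {H : E → W} (hf : ∀ y, f y = H y) {x : UnitSphere E}
    (hH : DifferentiableAt ℝ H x) (v : E) :
    sphDeriv f x v = fderiv ℝ H x (tangentProj x v) := by
  have hx : (x : E) ≠ 0 := ne_zero_of_mem_unit_sphere x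
  have heq : radialExt f =ᶠ[nhds (x : E)] fun y => H (‖y‖⁻¹ • y) := by
    filter_upwards [isOpen_ne.mem_nhds hx] with y hy
    rw [radialExt, dif_neg hy, hf]
    rfl
  -- The derivative is computed through `(√(‖y‖²))⁻¹`; together with `‖x‖ = 1` it makes the
  -- differential of `y ↦ y / ‖y‖` at `x` the tangential projection.
  have hn : HasFDerivAt (fun y : E => ‖y‖⁻¹) (-innerSL ℝ (x : E)) (x : E) := by
    have h1 : HasFDerivAt (fun y : E => ‖y‖ ^ 2) (2 • innerSL ℝ (x : E)) (x : E) :=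
      (hasStrictFDerivAt_norm_sq (x : E)).hasFDerivAt
    have h2 : HasDerivAt (fun t : ℝ => (√t)⁻¹) (-(1 / 2)) (‖(x : E)‖ ^ 2) := by
      exact ((Real.hasDerivAt_sqrt (x := ‖(x : E)‖ ^ 2) (by simp)).inv (by simp)).congr_deriv
        (by simp)
    have h3 := (h2.comp_hasFDerivAt (x : E) h1).congr_fderiv (g' := -innerSL ℝ (x : E))
      (by ext v; simp)
    exact h3.congr_of_eventuallyEq (Filter.Eventually.of_forall fun y => by simp)
  have hr : HasFDerivAt (fun y : E => ‖y‖⁻¹ • y)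
      ((‖(x : E)‖⁻¹ • ContinuousLinearMap.id ℝ E) +
        (-innerSL ℝ (x : E)).smulRight (x : E)) (x : E) := hn.smul (hasFDerivAt_id _)
  have hx1 : ‖(x : E)‖⁻¹ • (x : E) = x := by simp
  have hH' : HasFDerivAt H (fderiv ℝ H x) (‖(x : E)‖⁻¹ • (x : E)) := by
    rw [hx1]; exact hH.hasFDerivAt
  have hc : HasFDerivAt (fun y : E => H (‖y‖⁻¹ • y)) _ (x : E) := HasFDerivAt.comp (f := fun y : E => ‖y‖⁻¹ • y) (x : E) hH' hr
  rw [sphDeriv, heq.fderiv_eq, hc.fderiv, tangentProj_apply]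
  simp [sub_eq_add_neg]

/-- Tangential derivatives only depend on the values on the sphere. -/
theorem fderiv_eq_of_eqOn_sphere {W : Type*} [NormedAddCommGroup W] [InnerProductSpace ℝ W]
    {H K : E → W} (h : ∀ y : UnitSphere E, H y = K y)
    {x : UnitSphere E} (hH : DifferentiableAt ℝ H x) (hK : DifferentiableAt ℝ K x)
    {v : E} (hv : ⟪(x : E), v⟫ = 0) :
    fderiv ℝ H x v = fderiv ℝ K x v := by
  have h1 := sphDeriv_eq (f := fun y : UnitSphere E => H y) (fun _ => rfl) hH v
  rw [sphDeriv_eq h hK, tangentProj_of_inner_eq_zero hv] at h1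
  exact h1.symm

lemma hasFDerivAt_tangent (w x : E) :
    HasFDerivAt (fun y : E => w - ⟪y, w⟫ • y)
      (-(⟪x, w⟫ • ContinuousLinearMap.id ℝ E + (innerSL ℝ w).smulRight x)) x := by
  have h : HasFDerivAt (fun y : E => ⟪y, w⟫) (innerSL ℝ w) x := by
    simpa [real_inner_comm] using (innerSL ℝ w).hasFDerivAt (x := x)
  exact (h.smul (hasFDerivAt_id x)).const_sub w

/-- Only the factor `⟪y, w⟫` in `w - ⟪y, w⟫ y` matters: the other terms are normal. In particular
the field is parallel at every point where `w` is tangent, which kills the correction terms in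
`∇dφ`, `∇²σ` and the curvature. -/
lemma leviCivita_tangentField (w : E) (x : UnitSphere E) (v : E) :
    leviCivita (tangentField w) x v = -(⟪(x : E), w⟫ • tangentProj x v) := by
  rw [leviCivita, sphDeriv_eq (f := tangentField w) (H := fun y : E => w - ⟪y, w⟫ • y)
    (fun y => tangentProj_apply y w) (hasFDerivAt_tangent w x).differentiableAt,
    (hasFDerivAt_tangent w x).fderiv]
  simp [tangentProj_add, tangentProj_neg, tangentProj_smul, tangentProj_tangentProj,
    tangentProj_self]

lemma leviCivita_leviCivita_tangentField (v w : E) (x : UnitSphere E) {u : E}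
    (hu : ⟪(x : E), u⟫ = 0) (hv : ⟪(x : E), v⟫ = 0) (hw : ⟪(x : E), w⟫ = 0) :
    leviCivita (fun z => leviCivita (tangentField w) z (tangentField v z)) x u
      = -(⟪w, u⟫ • v) := by
  have hd : HasFDerivAt (fun y : E => -(⟪y, w⟫ • (v - ⟪y, v⟫ • y))) _ (x : E) :=
    (((innerSL ℝ w).hasFDerivAt.congr_of_eventuallyEq
      (Filter.Eventually.of_forall fun y => by simp [real_inner_comm])).smul
      (hasFDerivAt_tangent v x)).neg
  rw [leviCivita, sphDeriv_eq (H := fun y : E => -(⟪y, w⟫ • (v - ⟪y, v⟫ • y)))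
    (fun y => by
      rw [leviCivita_tangentField, tangentField, tangentProj_tangentProj, tangentProj_apply])
    hd.differentiableAt, hd.fderiv, tangentProj_of_inner_eq_zero hu]
  simp [hv, hw, tangentProj_neg, tangentProj_smul, tangentProj_of_inner_eq_zero hv]

/-- The unit sphere has constant sectional curvature one. -/
theorem curvature_eq (y : UnitSphere V) {u v w : V}
    (hu : ⟪(y : V), u⟫ = 0) (hv : ⟪(y : V), v⟫ = 0) (hw : ⟪(y : V), w⟫ = 0) :
    curvature y u v w = ⟪v, w⟫ • u - ⟪u, w⟫ • v := by
  rw [curvature, leviCivita_leviCivita_tangentField v w y hu hv hw,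
    leviCivita_leviCivita_tangentField u w y hv hu hw]
  simp only [leviCivita_tangentField, hw, zero_smul, neg_zero, sub_zero]
  rw [real_inner_comm w u, real_inner_comm w v]
  abel

/-- The Hessian, for the Levi-Civita connection of the unit sphere, of the restriction of `H` to
the sphere, written with ambient derivatives. -/
def sphereHessian (H : E → V) (x v w : E) : V :=
  fderiv ℝ (fderiv ℝ H) x v w - ⟪v, w⟫ • fderiv ℝ H x x

lemma differentiable_fderiv {W : Type*} [NormedAddCommGroup W] [NormedSpace ℝ W] {H : E → W}
    (hH : ContDiff ℝ 2 H) : Differentiable ℝ (fderiv ℝ H) :=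
  (hH.fderiv_right (m := 1) (by norm_num)).differentiable (by norm_num)

lemma hasFDerivAt_fderiv_tangent {H : E → V} (hH : ContDiff ℝ 2 H) (w x : E) :
    HasFDerivAt (fun y => fderiv ℝ H y (w - ⟪y, w⟫ • y))
      ((fderiv ℝ H x).comp
        (-(⟪x, w⟫ • ContinuousLinearMap.id ℝ E + (innerSL ℝ w).smulRight x)) +
        (fderiv ℝ (fderiv ℝ H) x).flip (w - ⟪x, w⟫ • x)) x :=
  (differentiable_fderiv hH x).hasFDerivAt.clm_apply (hasFDerivAt_tangent w x)

/-- Differentiating the projected direction `w - ⟪y, w⟫ y` produces the second fundamental form term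
of `sphereHessian`. -/
lemma fderiv_fderiv_tangent {H : E → V} (hH : ContDiff ℝ 2 H) {x v w : E}
    (hw : ⟪x, w⟫ = 0) :
    fderiv ℝ (fun y => fderiv ℝ H y (w - ⟪y, w⟫ • y)) x v = sphereHessian H x v w := by
  rw [(hasFDerivAt_fderiv_tangent hH w x).fderiv]
  simp [sphereHessian, hw, real_inner_comm v w]
  abel

/-- A map between unit spheres and a map of the ambient spaces extending it. -/
def Extends (F : E → V) (φ : UnitSphere E → UnitSphere V) : Prop := ∀ y, (φ y : V) = F y

/-! ### Tension and bitension fields through ambient extensions. -/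

variable {F : E → V} {φ : UnitSphere E → UnitSphere V}

lemma differential_eq (hφ : Extends F φ) (hF : ContDiff ℝ 2 F) (x : UnitSphere E) (v : E) :
    differential φ x v = fderiv ℝ F x (tangentProj x v) :=
  sphDeriv_eq hφ (hF.differentiable (by norm_num) _) v

lemma inner_apply_fderiv (hφ : Extends F φ) (hF : ContDiff ℝ 2 F) {x : UnitSphere E} {v : E}
    (hv : ⟪(x : E), v⟫ = 0) : ⟪F x, fderiv ℝ F x v⟫ = 0 := by
  have hd := hF.differentiable (by norm_num) (x : E)
  have h := fderiv_eq_of_eqOn_sphere (H := fun y => ⟪F y, F y⟫) (K := fun _ => (1 : ℝ))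
    (fun y => by rw [← hφ y, inner_self_coe]) (hd.inner ℝ hd) (differentiableAt_const _) hv
  rw [fderiv_inner_apply ℝ hd hd, real_inner_comm (F x)] at h
  simp at h
  linarith

lemma inner_differential (hφ : Extends F φ) (hF : ContDiff ℝ 2 F) (x : UnitSphere E) (v : E) :
    ⟪(φ x : V), differential φ x v⟫ = 0 := by
  rw [hφ, differential_eq hφ hF]
  exact inner_apply_fderiv hφ hF (inner_tangentProj x v)

/-- Differentiate `⟪F, dF(w)⟫ = 0` along the sphere, with `w` extended by projection. -/
lemma inner_sphereHessian (hφ : Extends F φ) (hF : ContDiff ℝ 2 F) {x : UnitSphere E} {v w : E}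
    (hv : ⟪(x : E), v⟫ = 0) (hw : ⟪(x : E), w⟫ = 0) :
    ⟪F x, sphereHessian F x v w⟫ = -⟪fderiv ℝ F x v, fderiv ℝ F x w⟫ := by
  have hd := hF.differentiable (by norm_num) (x : E)
  have hd' := (hasFDerivAt_fderiv_tangent hF w x).differentiableAt
  have h := fderiv_eq_of_eqOn_sphere (H := fun y => ⟪F y, fderiv ℝ F y (w - ⟪y, w⟫ • y)⟫)
    (K := fun _ => (0 : ℝ))
    (fun y => by
      rw [← tangentProj_apply]; exact inner_apply_fderiv hφ hF (inner_tangentProj y w))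
    (hd.inner ℝ hd') (differentiableAt_const _) hv
  rw [fderiv_inner_apply ℝ hd hd', fderiv_fderiv_tangent hF hw] at h
  simp [hw] at h
  linarith

lemma covDerivDifferential_eq (hφ : Extends F φ) (hF : ContDiff ℝ 2 F) {x : UnitSphere E} {v w : E}
    (hv : ⟪(x : E), v⟫ = 0) (hw : ⟪(x : E), w⟫ = 0) :
    covDerivDifferential φ x v w = tangentProj (φ x) (sphereHessian F x v w) := by
  rw [covDerivDifferential, leviCivita_tangentField, hw, differential_eq hφ hF, pullbackConn,
    sphDeriv_eq (H := fun y => fderiv ℝ F y (w - ⟪y, w⟫ • y))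
      (fun y => by
        rw [differential_eq hφ hF, tangentField, tangentProj_tangentProj, tangentProj_apply])
      (hasFDerivAt_fderiv_tangent hF w x).differentiableAt, tangentProj_of_inner_eq_zero hv,
    fderiv_fderiv_tangent hF hw]
  simp [tangentProj]

lemma pullbackConn_eq {σ : UnitSphere E → V} {T : E → V} (hσ : ∀ y, σ y = T y)
    (hT : ContDiff ℝ 2 T) (x : UnitSphere E) (v : E) :
    pullbackConn φ σ x v = tangentProj (φ x) (fderiv ℝ T x (tangentProj x v)) := by
  rw [pullbackConn, sphDeriv_eq hσ (hT.differentiable (by norm_num) _)]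

/-- The inner connection removes `⟪F, dT(w)⟫ F`. After the outer projection its derivative leaves
`-⟪F, dT(w)⟫ dF(v)`, and `⟪F, T⟫ = 0` turns the coefficient into `⟪dF(w), T⟫`. -/
lemma secondCovDeriv_eq (hφ : Extends F φ) (hF : ContDiff ℝ 2 F) {σ : UnitSphere E → V} {T : E → V}
    (hσ : ∀ y, σ y = T y) (hT : ContDiff ℝ 2 T) (hFT : ∀ y : UnitSphere E, ⟪F y, T y⟫ = 0)
    {x : UnitSphere E} {v w : E} (hv : ⟪(x : E), v⟫ = 0) (hw : ⟪(x : E), w⟫ = 0) :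
    secondCovDeriv φ σ x v w = tangentProj (φ x) (sphereHessian T x v w)
      + ⟪fderiv ℝ F x w, T x⟫ • fderiv ℝ F x v := by
  have hFd := hF.differentiable (by norm_num) (x : E)
  have hTd := hT.differentiable (by norm_num) (x : E)
  have hT' := hasFDerivAt_fderiv_tangent hT w (x : E)
  have hc : ⟪F x, fderiv ℝ T x w⟫ = -⟪fderiv ℝ F x w, T x⟫ := by
    have h := fderiv_eq_of_eqOn_sphere (H := fun y => ⟪F y, T y⟫) (K := fun _ => (0 : ℝ))
      hFT (hFd.inner ℝ hTd) (differentiableAt_const _) hw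
    rw [fderiv_inner_apply ℝ hFd hTd] at h
    simp at h
    linarith
  have hd : HasFDerivAt (fun y => fderiv ℝ T y (w - ⟪y, w⟫ • y)
      - ⟪F y, fderiv ℝ T y (w - ⟪y, w⟫ • y)⟫ • F y) _ (x : E) :=
    hT'.sub ((hFd.inner ℝ hT'.differentiableAt).hasFDerivAt.smul hFd.hasFDerivAt)
  rw [secondCovDeriv, leviCivita_tangentField, hw, pullbackConn_eq hσ hT, pullbackConn,
    sphDeriv_eq (H := fun y => fderiv ℝ T y (w - ⟪y, w⟫ • y)
      - ⟪F y, fderiv ℝ T y (w - ⟪y, w⟫ • y)⟫ • F y)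
      (fun y => by
        rw [pullbackConn_eq hσ hT, tangentField, tangentProj_tangentProj, tangentProj_apply (φ y),
          tangentProj_apply y, hφ y])
      hd.differentiableAt, tangentProj_of_inner_eq_zero hv, hd.fderiv]
  have h1 := fderiv_fderiv_tangent hT (v := v) hw
  rw [hT'.fderiv] at h1
  have h2 : tangentProj (φ x) (fderiv ℝ F x v) = fderiv ℝ F x v :=
    tangentProj_of_inner_eq_zero (by rw [hφ x]; exact inner_apply_fderiv hφ hF hv)
  rw [sub_apply, h1, tangentProj_sub, add_apply, smul_apply,
    ContinuousLinearMap.smulRight_apply, ← hφ x, tangentProj_add, tangentProj_smul_self,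
    tangentProj_smul, h2, hw, zero_smul, sub_zero, hφ x, hc]
  simp [tangentProj]

variable [FiniteDimensional ℝ E]

/-- The Laplacian of the unit sphere, applied to the restriction of `H`. -/
def sphereLaplacian (H : E → V) (x : UnitSphere E) : V := tangentTrace x (sphereHessian H x)

lemma inner_tangentBasis (x : UnitSphere E) (i) :
    ⟪(x : E), (stdOrthonormalBasis ℝ (tangentSpace x) i : E)⟫ = 0 :=
  Submodule.mem_orthogonal_singleton_iff_inner_right.1 (stdOrthonormalBasis ℝ _ i).2

lemma tangentTrace_congr {W : Type*} [NormedAddCommGroup W] (x : UnitSphere E) {A B : E → E → W}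
    (h : ∀ v w, ⟪(x : E), v⟫ = 0 → ⟪(x : E), w⟫ = 0 → A v w = B v w) :
    tangentTrace x A = tangentTrace x B :=
  Finset.sum_congr rfl fun _ _ => h _ _ (inner_tangentBasis x _) (inner_tangentBasis x _)

/-- The tension field of a map between spheres is the tangential part of the Laplacian. -/
theorem tensionField_eq (hφ : Extends F φ) (hF : ContDiff ℝ 2 F) (x : UnitSphere E) :
    tensionField φ x = tangentProj (φ x) (sphereLaplacian F x) := by
  rw [tensionField, tangentTrace_congr x fun v w => covDerivDifferential_eq hφ hF]
  simp only [tangentTrace, sphereLaplacian, tangentProj, map_sum]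

lemma inner_sphereLaplacian (hφ : Extends F φ) (hF : ContDiff ℝ 2 F) (x : UnitSphere E) :
    ⟪F x, sphereLaplacian F x⟫
      = -tangentTrace x fun v w => ⟪fderiv ℝ F x v, fderiv ℝ F x w⟫ := by
  simp only [sphereLaplacian, tangentTrace, inner_sum, ← Finset.sum_neg_distrib]
  exact Finset.sum_congr rfl fun _ _ =>
    inner_sphereHessian hφ hF (inner_tangentBasis x _) (inner_tangentBasis x _)

/-- The bitension field of a map between spheres whose tension field is the restriction of `T`. -/
theorem bitensionField_eq (hφ : Extends F φ) (hF : ContDiff ℝ 2 F) {T : E → V}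
    (hτ : ∀ y, tensionField φ y = T y) (hT : ContDiff ℝ 2 T) (x : UnitSphere E) :
    bitensionField φ x = tangentProj (φ x) (sphereLaplacian T x)
      - ⟪F x, sphereLaplacian F x⟫ • T x := by
  have hFT : ∀ y : UnitSphere E, ⟪F y, T y⟫ = 0 := fun y => by
    rw [← hτ, tensionField_eq hφ hF, ← hφ]; exact inner_tangentProj _ _
  rw [bitensionField, roughLaplacian,
    tangentTrace_congr x fun v w => secondCovDeriv_eq hφ hF hτ hT hFT,
    -- Constant curvature one: the first term cancels the extra term of `secondCovDeriv_eq`, the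
    -- second contributes `|dφ|² T`.
    tangentTrace_congr x (A := fun v w => curvature _ _ _ _) (B := fun v w => ⟪fderiv ℝ F x w, T x⟫ • fderiv ℝ F x v
        - ⟪fderiv ℝ F x v, fderiv ℝ F x w⟫ • T x) fun v w hv hw => by
      rw [curvature_eq _ (inner_differential hφ hF x v)
        (by rw [hτ, hφ]; exact hFT x) (inner_differential hφ hF x w),
        differential_eq hφ hF, differential_eq hφ hF, tangentProj_of_inner_eq_zero hv,
        tangentProj_of_inner_eq_zero hw, hτ, real_inner_comm (fderiv ℝ F x w)],
    inner_sphereLaplacian hφ hF]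
  simp only [tangentTrace, sphereLaplacian, tangentProj, map_sum, Finset.sum_add_distrib,
    Finset.sum_sub_distrib, neg_smul, Finset.sum_smul]
  abel

end SphereCalculus

/-! ### The Laplacian of the sphere compared with the Euclidean one. -/

section SphereLaplacian

variable {E : Type*} [NormedAddCommGroup E] [InnerProductSpace ℝ E]
variable {V : Type*} [NormedAddCommGroup V] [InnerProductSpace ℝ V]

lemma sphereHessian_sub {H K : E → V} (hH : ContDiff ℝ 2 H) (hK : ContDiff ℝ 2 K) (x v w : E) :
    sphereHessian (fun y => H y - K y) x v w = sphereHessian H x v w - sphereHessian K x v w := by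
  have h : fderiv ℝ (fun y => H y - K y) = fun y => fderiv ℝ H y - fderiv ℝ K y :=
    funext fun y => fderiv_fun_sub (hH.differentiable (by norm_num) y)
      (hK.differentiable (by norm_num) y)
  simp only [sphereHessian, h]
  rw [fderiv_fun_sub (differentiable_fderiv hH x) (differentiable_fderiv hK x)]
  simp only [sub_apply, smul_sub]
  abel

lemma sphereHessian_const_smul {H : E → V} (hH : ContDiff ℝ 2 H) (c : ℝ) (x v w : E) :
    sphereHessian (fun y => c • H y) x v w = c • sphereHessian H x v w := by
  have h : fderiv ℝ (fun y => c • H y) = fun y => c • fderiv ℝ H y :=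
    funext fun y => fderiv_fun_const_smul (hH.differentiable (by norm_num) y) c
  simp only [sphereHessian, h]
  rw [fderiv_fun_const_smul (differentiable_fderiv hH x)]
  simp only [smul_apply, smul_sub, smul_comm c]

/-- Both derivatives are tangential, so each sees only values on the sphere. This lets a tension
field vanishing on the sphere be replaced by the zero extension. -/
lemma sphereHessian_congr {H K : E → V} (h : ∀ y : UnitSphere E, H y = K y)
    (hH : ContDiff ℝ 2 H) (hK : ContDiff ℝ 2 K) {x : UnitSphere E} {v w : E}
    (hv : ⟪(x : E), v⟫ = 0) (hw : ⟪(x : E), w⟫ = 0) :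
    sphereHessian H x v w = sphereHessian K x v w := by
  rw [← fderiv_fderiv_tangent hH hw, ← fderiv_fderiv_tangent hK hw]
  refine fderiv_eq_of_eqOn_sphere (fun y => ?_)
    (hasFDerivAt_fderiv_tangent hH w x).differentiableAt
    (hasFDerivAt_fderiv_tangent hK w x).differentiableAt hv
  rw [← tangentProj_apply]
  exact fderiv_eq_of_eqOn_sphere h (hH.differentiable (by norm_num) _)
    (hK.differentiable (by norm_num) _) (inner_tangentProj y w)

/-- Euler's identity for homogeneous maps. -/
lemma fderiv_self_of_homogeneous {H : E → V} {d : ℕ} (hH : Differentiable ℝ H)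
    (hom : ∀ (t : ℝ) x, H (t • x) = t ^ d • H x) (x : E) :
    fderiv ℝ H x x = (d : ℝ) • H x := by
  have h1 : HasDerivAt (fun t : ℝ => t • x) x 1 := by
    simpa using (hasDerivAt_id (1 : ℝ)).smul_const x
  have h2 : HasFDerivAt H (fderiv ℝ H x) ((1 : ℝ) • x) := by
    rw [one_smul]; exact (hH x).hasFDerivAt
  have h3 : HasDerivAt (fun t : ℝ => H (t • x)) (fderiv ℝ H x x) 1 := h2.comp_hasDerivAt 1 h1
  have h4 : HasDerivAt (fun t : ℝ => H (t • x)) ((d : ℝ) • H x) 1 := by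
    simp only [hom]
    simpa using (hasDerivAt_pow d (1 : ℝ)).smul_const (H x)
  exact h3.unique h4

lemma fderiv_fderiv_symm {W : Type*} [NormedAddCommGroup W] [NormedSpace ℝ W] {H : E → W}
    (hH : ContDiff ℝ 2 H) (x v w : E) :
    fderiv ℝ (fderiv ℝ H) x v w = fderiv ℝ (fderiv ℝ H) x w v :=
  hH.contDiffAt.isSymmSndFDerivAt (by simp) v w

/-- The derivative of a map satisfying Euler's identity of degree `d` satisfies it in degree
`d - 1`. -/
lemma fderiv_fderiv_self {H : E → V} {d : ℝ} (hH : ContDiff ℝ 2 H)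
    (hE : ∀ x, fderiv ℝ H x x = d • H x) (x : E) :
    fderiv ℝ (fderiv ℝ H) x x = (d - 1) • fderiv ℝ H x := by
  ext v
  have h1 : HasFDerivAt (fun y => fderiv ℝ H y y) _ x :=
    (differentiable_fderiv hH x).hasFDerivAt.clm_apply (hasFDerivAt_id x)
  have h2 : HasFDerivAt (fun y => fderiv ℝ H y y) (d • fderiv ℝ H x) x := by
    simp only [hE]
    exact (hH.differentiable (by norm_num) x).hasFDerivAt.const_smul d
  have h3 := congrArg (fun A => A v) (h1.unique h2)
  simp only [ContinuousLinearMap.comp_id, add_apply,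
    ContinuousLinearMap.flip_apply, smul_apply] at h3
  rw [fderiv_fderiv_symm hH, smul_apply, sub_smul, one_smul, ← h3]
  abel

variable [FiniteDimensional ℝ E]

lemma sphereLaplacian_sub {H K : E → V} (hH : ContDiff ℝ 2 H) (hK : ContDiff ℝ 2 K)
    (x : UnitSphere E) :
    sphereLaplacian (fun y => H y - K y) x = sphereLaplacian H x - sphereLaplacian K x := by
  simp only [sphereLaplacian, tangentTrace, sphereHessian_sub hH hK, Finset.sum_sub_distrib]

lemma sphereLaplacian_const_smul {H : E → V} (hH : ContDiff ℝ 2 H) (c : ℝ)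
    (x : UnitSphere E) :
    sphereLaplacian (fun y => c • H y) x = c • sphereLaplacian H x := by
  simp only [sphereLaplacian, tangentTrace, sphereHessian_const_smul hH, Finset.smul_sum]

lemma sphereLaplacian_congr {H K : E → V} (h : ∀ y : UnitSphere E, H y = K y)
    (hH : ContDiff ℝ 2 H) (hK : ContDiff ℝ 2 K) (x : UnitSphere E) :
    sphereLaplacian H x = sphereLaplacian K x :=
  tangentTrace_congr x fun _ _ hv hw => sphereHessian_congr h hH hK hv hw

lemma laplacian_eq_sum {W : Type*} [NormedAddCommGroup W] [NormedSpace ℝ W]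
    {ι : Type*} [Fintype ι] (b : OrthonormalBasis ι ℝ E) (H : E → W) (x : E) :
    Δ H x = ∑ i, fderiv ℝ (fderiv ℝ H) x (b i) (b i) := by
  rw [laplacian_eq_iteratedFDeriv_orthonormalBasis H b]
  simp [iteratedFDeriv_two_apply]

omit [FiniteDimensional ℝ E] in
lemma finrank_tangentSpace {m : ℕ} (hm : Module.finrank ℝ E = m + 1) (x : UnitSphere E) :
    Module.finrank ℝ (tangentSpace x) = m := by
  have : Fact (Module.finrank ℝ E = m + 1) := ⟨hm⟩
  exact Submodule.finrank_orthogonal_span_singleton (ne_zero_of_mem_unit_sphere x)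

/-- An orthonormal basis of the ambient space made of a point of the unit sphere and an
orthonormal basis of the tangent space at this point. -/
lemma exists_orthonormalBasis_option (x : UnitSphere E) :
    ∃ b : OrthonormalBasis (Option (Fin (Module.finrank ℝ (tangentSpace x)))) ℝ E,
      b none = x ∧ ∀ i, b (some i) = stdOrthonormalBasis ℝ (tangentSpace x) i := by
  let f : Option (Fin (Module.finrank ℝ (tangentSpace x))) → E :=
    fun o => o.elim (x : E) fun i => (stdOrthonormalBasis ℝ (tangentSpace x) i : E)
  have hf : Orthonormal ℝ f := by
    have ho := (stdOrthonormalBasis ℝ (tangentSpace x)).orthonormal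
    constructor
    · rintro (_ | i)
      · exact norm_coe x
      · exact ho.1 i
    · rintro (_ | i) (_ | j) hij
      · exact absurd rfl hij
      · exact inner_tangentBasis x j
      · exact (real_inner_comm _ _).trans (inner_tangentBasis x i)
      · exact ho.2 fun h => hij (congrArg some h)
  have hcard : Fintype.card (Option (Fin (Module.finrank ℝ (tangentSpace x))))
      = Module.finrank ℝ E := by
    have h := Submodule.finrank_add_finrank_orthogonal (ℝ ∙ (x : E))
    rw [finrank_span_singleton (ne_zero_of_mem_unit_sphere x)] at h
    rw [Fintype.card_option, Fintype.card_fin, ← h, add_comm]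
  let b := (basisOfOrthonormalOfCardEqFinrank hf hcard).toOrthonormalBasis (by simpa using hf)
  have hb : ∀ o, b o = f o := fun o => by simp [b]
  exact ⟨b, hb none, fun i => hb (some i)⟩

/-- Complete a tangent basis by the normal `x`: the Euclidean trace has one extra term `D²H(x, x)`,
and the trace of `⟪v, w⟫` over the tangent space is `m`. -/
lemma sphereLaplacian_eq {m : ℕ} (hm : Module.finrank ℝ E = m + 1) (H : E → V)
    (x : UnitSphere E) :
    sphereLaplacian H x
      = Δ H x - fderiv ℝ (fderiv ℝ H) x x x - (m : ℝ) • fderiv ℝ H x x := by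
  obtain ⟨b, hb, hb'⟩ := exists_orthonormalBasis_option x
  have h1 : ∀ i, ⟪(stdOrthonormalBasis ℝ (tangentSpace x) i : E),
      (stdOrthonormalBasis ℝ (tangentSpace x) i : E)⟫ = 1 := fun i => by
    rw [← Submodule.coe_inner, real_inner_self_eq_norm_sq,
      (stdOrthonormalBasis ℝ (tangentSpace x)).norm_eq_one, one_pow]
  rw [laplacian_eq_sum b, Fintype.sum_option, hb]
  simp only [hb', sphereLaplacian, tangentTrace, sphereHessian, h1, Finset.sum_sub_distrib,
    one_smul, Finset.sum_const, Finset.card_univ, Fintype.card_fin, finrank_tangentSpace hm,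
    Nat.cast_smul_eq_nsmul]
  abel

/-- The Laplacian on the sphere of a homogeneous map. -/
lemma sphereLaplacian_of_euler {m : ℕ} (hm : Module.finrank ℝ E = m + 1) {H : E → V} {d : ℝ}
    (hH : ContDiff ℝ 2 H) (hE : ∀ x, fderiv ℝ H x x = d • H x) (x : UnitSphere E) :
    sphereLaplacian H x = Δ H x - (d * (d - 1 + m)) • H x := by
  rw [sphereLaplacian_eq hm, fderiv_fderiv_self hH hE, smul_apply, hE]
  module

/-- The derivative of a harmonic map is harmonic. -/
lemma laplacian_fderiv {G : E → V} (hG : ContDiff ℝ 3 G) (hΔ : Δ G = 0) :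
    Δ (fderiv ℝ G) = 0 := by
  have hG2 : ContDiff ℝ 2 G := hG.of_le (by norm_num)
  have hG' : ContDiff ℝ 2 (fderiv ℝ G) := hG.fderiv_right (by norm_num)
  have hd := differentiable_fderiv hG'
  funext x
  ext v
  let b := stdOrthonormalBasis ℝ E
  have h0 : (fun y => ∑ i, fderiv ℝ (fderiv ℝ G) y (b i) (b i)) = 0 :=
    (funext fun y => (laplacian_eq_sum b G y).symm).trans hΔ
  have hD : ∀ u w z : E, HasFDerivAt (fun y => fderiv ℝ (fderiv ℝ G) y u w)
      (((fderiv ℝ (fderiv ℝ (fderiv ℝ G)) x).flip u).flip w) x := fun u w z =>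
    (((hd x).hasFDerivAt.clm_apply (hasFDerivAt_const u x)).clm_apply
      (hasFDerivAt_const w x)).congr_fderiv (by ext; simp)
  have h1 : HasFDerivAt (fun y => ∑ i, fderiv ℝ (fderiv ℝ G) y (b i) (b i)) _ x :=
    HasFDerivAt.fun_sum fun i _ => hD (b i) (b i) x
  rw [h0] at h1
  have h2 := congrArg (fun A => A v) (h1.unique (hasFDerivAt_const (0 : V) x))
  simp only [sum_apply, ContinuousLinearMap.flip_apply, zero_apply] at h2
  rw [laplacian_eq_sum b, sum_apply, Pi.zero_apply, zero_apply, ← h2]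
  refine Finset.sum_congr rfl fun i _ => ?_
  rw [fderiv_fderiv_symm hG' x v (b i)]
  -- The last two slots of the third derivative are exchanged by differentiating the symmetry of the
  -- second derivative.
  have h3 : (fun y => fderiv ℝ (fderiv ℝ G) y (b i) v)
      = fun y => fderiv ℝ (fderiv ℝ G) y v (b i) :=
    funext fun y => fderiv_fderiv_symm hG2 y _ _
  have h4 := hD (b i) v x
  rw [h3] at h4
  have h5 := congrArg (fun A => A (b i)) (h4.unique (hD v (b i) x))
  simpa using h5

end SphereLaplacian

/-! ### Derivatives of `x ⊗ G x` and the contraction of `dG`. -/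

section TensorProduct

variable {E : Type*} [NormedAddCommGroup E] [InnerProductSpace ℝ E] [FiniteDimensional ℝ E]
variable {V : Type*} [NormedAddCommGroup V] [InnerProductSpace ℝ V]
variable {W : Type*} [NormedAddCommGroup W] [InnerProductSpace ℝ W]
variable (B : E →L[ℝ] V →L[ℝ] W)

/-- The contraction `A ↦ ∑ eᵢ ⊗ A eᵢ` for a bilinear product `B`. -/
def contraction : (E →L[ℝ] V) →L[ℝ] W :=
  ∑ i, (B (stdOrthonormalBasis ℝ E i)).comp
    (ContinuousLinearMap.apply ℝ V (stdOrthonormalBasis ℝ E i))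

lemma contraction_apply (A : E →L[ℝ] V) :
    contraction B A = ∑ i, B (stdOrthonormalBasis ℝ E i) (A (stdOrthonormalBasis ℝ E i)) := by
  simp [contraction]

variable {B} in
lemma inner_contraction (hB : ∀ u v c d, ⟪B u c, B v d⟫ = ⟪u, v⟫ * ⟪c, d⟫) (A : E →L[ℝ] V)
    (x : E) (c : V) : ⟪B x c, contraction B A⟫ = ⟪c, A x⟫ := by
  conv_rhs => rw [← (stdOrthonormalBasis ℝ E).sum_repr' x]
  simp only [contraction_apply, inner_sum, hB, map_sum, map_smul, inner_smul_right]
  exact Finset.sum_congr rfl fun i _ => by rw [real_inner_comm x]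

variable {G : E → V}

omit [FiniteDimensional ℝ E] in
lemma contDiff_bilinear {n : ℕ∞ω} (hG : ContDiff ℝ n G) : ContDiff ℝ n fun x => B x (G x) :=
  B.contDiff.clm_apply hG

omit [FiniteDimensional ℝ E] in
lemma fderiv_bilinear (hG : Differentiable ℝ G) (x v : E) :
    fderiv ℝ (fun y => B y (G y)) x v = B v (G x) + B x (fderiv ℝ G x v) := by
  have h : HasFDerivAt (fun y => B y (G y)) _ x := B.hasFDerivAt.clm_apply (hG x).hasFDerivAt
  rw [h.fderiv]
  simp [add_comm]

omit [FiniteDimensional ℝ E] in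
lemma fderiv_fderiv_bilinear (hG : ContDiff ℝ 2 G) (x v w : E) :
    fderiv ℝ (fderiv ℝ fun y => B y (G y)) x v w
      = B w (fderiv ℝ G x v) + B v (fderiv ℝ G x w) + B x (fderiv ℝ (fderiv ℝ G) x v w) := by
  have hGd := hG.differentiable (by norm_num)
  have h1 := (differentiable_fderiv (contDiff_bilinear B hG) x).hasFDerivAt.clm_apply
    (hasFDerivAt_const w x)
  have h2 : HasFDerivAt (fun y => B w (G y) + B y (fderiv ℝ G y w)) _ x :=
    ((B w).hasFDerivAt.comp x (hGd x).hasFDerivAt).add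
      (B.hasFDerivAt.clm_apply
        ((differentiable_fderiv hG x).hasFDerivAt.clm_apply (hasFDerivAt_const w x)))
  simp only [fderiv_bilinear B hGd] at h1
  have h3 := congrArg (fun A => A v) (h1.unique h2)
  simp at h3
  rw [h3]
  abel

/-- The two cross terms of the product rule coincide on the diagonal, giving the factor `2`; `x ↦ x`
itself has no second derivative. -/
lemma laplacian_bilinear (hG : ContDiff ℝ 2 G) (x : E) :
    Δ (fun y => B y (G y)) x = (2 : ℝ) • contraction B (fderiv ℝ G x) + B x (Δ G x) := by
  simp only [laplacian_eq_sum (stdOrthonormalBasis ℝ E), fderiv_fderiv_bilinear B hG,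
    contraction_apply, Finset.sum_add_distrib, map_sum, two_smul]

/-- The contraction is a fixed linear map, hence commutes with `Δ`, and `dG` is harmonic. -/
lemma laplacian_contraction (hG : ContDiff ℝ 3 G) (hΔ : Δ G = 0) (x : E) :
    Δ (fun y => contraction B (fderiv ℝ G y)) x = 0 := by
  have hG' : ContDiff ℝ 2 (fderiv ℝ G) := hG.fderiv_right (by norm_num)
  have h := hG'.contDiffAt (x := x).laplacian_CLM_comp_left (l := contraction B)
  rw [laplacian_fderiv hG hΔ] at h
  simpa [Function.comp_def] using h

end TensorProduct

/-! ### Tension and bitension of `x ↦ x ⊗ G x` on the sphere. -/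

section ProductWithIdentity

variable {E : Type*} [NormedAddCommGroup E] [InnerProductSpace ℝ E] [FiniteDimensional ℝ E]
variable {V : Type*} [NormedAddCommGroup V] [InnerProductSpace ℝ V]
variable {W : Type*} [NormedAddCommGroup W] [InnerProductSpace ℝ W]

/-- The vector field along `x ↦ x ⊗ G x` which restricts to the tension field of this map. -/
def tensionExt (B : E →L[ℝ] V →L[ℝ] W) (G : E → V) (k : ℕ) (x : E) : W :=
  (2 : ℝ) • contraction B (fderiv ℝ G x) - (2 * k : ℝ) • B x (G x)

variable {B : E →L[ℝ] V →L[ℝ] W} {G : E → V} {m k : ℕ}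

lemma contDiff_contraction (hG : ContDiff ℝ 3 G) :
    ContDiff ℝ 2 fun x => contraction B (fderiv ℝ G x) :=
  (contraction B).contDiff.comp (hG.fderiv_right (by norm_num))

lemma contDiff_tensionExt (hG : ContDiff ℝ 3 G) : ContDiff ℝ 2 (tensionExt B G k) :=
  ((contDiff_contraction hG).const_smul _).sub
    ((contDiff_bilinear B (hG.of_le (by norm_num))).const_smul _)

lemma sphereLaplacian_bilinear (hm : Module.finrank ℝ E = m + 1) (hG : ContDiff ℝ 3 G)
    (hΔ : Δ G = 0) (hE : ∀ x, fderiv ℝ G x x = (k : ℝ) • G x) (x : UnitSphere E) :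
    sphereLaplacian (fun y => B y (G y)) x = (2 : ℝ) • contraction B (fderiv ℝ G x)
      - ((k + 1 : ℝ) * (k + m)) • B x (G x) := by
  have hG2 : ContDiff ℝ 2 G := hG.of_le (by norm_num)
  rw [sphereLaplacian_of_euler hm (d := k + 1) (contDiff_bilinear B hG2) fun y => by
    rw [fderiv_bilinear B (hG2.differentiable (by norm_num)), hE, map_smul]; module,
    laplacian_bilinear B hG2, hΔ, Pi.zero_apply, map_zero]
  module

lemma sphereLaplacian_contraction (hm : Module.finrank ℝ E = m + 1) (hG : ContDiff ℝ 3 G)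
    (hΔ : Δ G = 0) (hE : ∀ x, fderiv ℝ G x x = (k : ℝ) • G x) (x : UnitSphere E) :
    sphereLaplacian (fun y => contraction B (fderiv ℝ G y)) x
      = -((k - 1 : ℝ) * (k - 2 + m)) • contraction B (fderiv ℝ G x) := by
  have hG2 : ContDiff ℝ 2 G := hG.of_le (by norm_num)
  -- The degree `k - 1` is a real number, so `k = 0` suffers no truncation.
  rw [sphereLaplacian_of_euler hm (d := k - 1) (contDiff_contraction hG) fun y => by
    have h : HasFDerivAt (fun y => contraction B (fderiv ℝ G y)) _ y :=
      (contraction B).hasFDerivAt.comp y (differentiable_fderiv hG2 y).hasFDerivAt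
    rw [h.fderiv, ContinuousLinearMap.comp_apply, fderiv_fderiv_self hG2 hE, map_smul],
    laplacian_contraction B hG hΔ]
  module

lemma sphereLaplacian_tensionExt (hm : Module.finrank ℝ E = m + 1) (hG : ContDiff ℝ 3 G)
    (hΔ : Δ G = 0) (hE : ∀ x, fderiv ℝ G x x = (k : ℝ) • G x) (x : UnitSphere E) :
    sphereLaplacian (tensionExt B G k) x
      = (-((k - 1 : ℝ) * (k - 2 + m)) - 2 * k) • ((2 : ℝ) • contraction B (fderiv ℝ G x))
        + (2 * k * ((k + 1 : ℝ) * (k + m))) • B x (G x) := by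
  have hB := contDiff_bilinear B (hG.of_le (by norm_num : (2 : ℕ∞ω) ≤ 3))
  have hC := contDiff_contraction (B := B) hG
  unfold tensionExt
  rw [sphereLaplacian_sub (hC.const_smul _) (hB.const_smul _), sphereLaplacian_const_smul hC,
    sphereLaplacian_const_smul hB, sphereLaplacian_contraction hm hG hΔ hE,
    sphereLaplacian_bilinear hm hG hΔ hE]
  module

variable (hB : ∀ u v c d, ⟪B u c, B v d⟫ = ⟪u, v⟫ * ⟪c, d⟫)
  (hG : ContDiff ℝ 3 G) (hE : ∀ x, fderiv ℝ G x x = (k : ℝ) • G x)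
  {φ : UnitSphere E → UnitSphere W} (hφ : Extends (fun y => B y (G y)) φ)

include hB hE hφ in
-- The pairing reduces to `⟪G x, dG(x)⟫`, which is `k |G x|²` by Euler; `|G x| = 1` because `x ⊗ G
-- x` and `x` are unit vectors.
lemma inner_bilinear_contraction (x : UnitSphere E) :
    ⟪B x (G x), contraction B (fderiv ℝ G x)⟫ = k := by
  have h : ⟪B x (G x), B x (G x)⟫ = 1 := by
    have := inner_self_coe (φ x)
    rwa [hφ x] at this
  rw [hB, inner_self_coe, one_mul] at h
  rw [inner_contraction hB, hE, inner_smul_right, h, mul_one]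

include hB hE hφ in
lemma tangentProj_contraction (x : UnitSphere E) :
    tangentProj (φ x) ((2 : ℝ) • contraction B (fderiv ℝ G x)) = tensionExt B G k x := by
  rw [tangentProj_apply, hφ, inner_smul_right, inner_bilinear_contraction hB hE hφ, tensionExt]

include hB hG hE hφ in
/-- The tension field of the restriction of `x ↦ x ⊗ G x` to the sphere. -/
theorem tensionField_bilinear (hm : Module.finrank ℝ E = m + 1) (hΔ : Δ G = 0)
    (x : UnitSphere E) : tensionField φ x = tensionExt B G k x := by
  rw [tensionField_eq hφ (contDiff_bilinear B (hG.of_le (by norm_num))),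
    sphereLaplacian_bilinear hm hG hΔ hE, tangentProj_sub, tangentProj_contraction hB hE hφ,
    show B x (G x) = φ x from (hφ x).symm, tangentProj_smul_self, sub_zero]

include hB hG hE hφ in
lemma inner_sphereLaplacian_bilinear (hm : Module.finrank ℝ E = m + 1) (hΔ : Δ G = 0)
    (x : UnitSphere E) : ⟪B x (G x), sphereLaplacian (fun y => B y (G y)) x⟫
      = 2 * k - (k + 1) * (k + m) := by
  have h : ⟪B x (G x), B x (G x)⟫ = 1 := by
    have := inner_self_coe (φ x)
    rwa [hφ x] at this
  rw [sphereLaplacian_bilinear hm hG hΔ hE, inner_sub_right, inner_smul_right, inner_smul_right,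
    inner_bilinear_contraction hB hE hφ, h, mul_one]

include hB hG hE hφ in
/-- The bitension field of the restriction of `x ↦ x ⊗ G x` to the sphere is proportional to its
tension field. -/
theorem bitensionField_bilinear (hm : Module.finrank ℝ E = m + 1) (hΔ : Δ G = 0)
    (x : UnitSphere E) : bitensionField φ x = (2 * (m - 1) : ℝ) • tensionField φ x := by
  have hτ := tensionField_bilinear hB hG hE hφ hm hΔ
  rw [bitensionField_eq hφ (contDiff_bilinear B (hG.of_le (by norm_num))) hτ
    (contDiff_tensionExt hG), inner_sphereLaplacian_bilinear hB hG hE hφ hm hΔ,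
    sphereLaplacian_tensionExt hm hG hΔ hE, tangentProj_add, tangentProj_smul,
    tangentProj_contraction hB hE hφ, show B x (G x) = φ x from (hφ x).symm,
    tangentProj_smul_self, hτ]
  -- The coefficient is `-(k - 1)(k - 2 + m) - 2k - (2k - (k + 1)(k + m)) = 2(m - 1)`.
  module

include hB hG hE hφ in
/-- The map `x ↦ x ⊗ G x` on the circle is not harmonic, unless `G` has degree zero. -/
theorem degree_eq_zero_of_tensionField_eq_zero (hm : Module.finrank ℝ E = 1 + 1) (hΔ : Δ G = 0)
    (hτ : ∀ x, tensionField φ x = 0) (x : UnitSphere E) : k = 0 := by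
  have h0 : ∀ y : UnitSphere E, tensionExt B G k y = (fun _ => (0 : W)) (y : E) := fun y => by
    rw [← tensionField_bilinear hB hG hE hφ hm hΔ, hτ]
  have hL := sphereLaplacian_congr h0 (contDiff_tensionExt hG) contDiff_const x
  have hz : sphereLaplacian (fun _ : E => (0 : W)) x = 0 := by
    simp [sphereLaplacian_eq hm, laplacian_const]
  have h1 : ⟪B x (G x), B x (G x)⟫ = 1 := by
    have := inner_self_coe (φ x)
    rwa [hφ x] at this
  rw [hz, sphereLaplacian_tensionExt hm hG hΔ hE] at hL
  have h2 := congrArg (fun w => ⟪B x (G x), w⟫) hL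
  simp only [inner_add_right, inner_smul_right, inner_bilinear_contraction hB hE hφ, h1,
    inner_zero_right] at h2
  -- With `m = 1` the pairing of `L τ` with `F` equals `4k²`.
  have h3 : (k : ℝ) ^ 2 = 0 := by push_cast at h2; linarith
  exact_mod_cast pow_eq_zero_iff (two_ne_zero) |>.1 h3

end ProductWithIdentity

/-! ### Polynomial forms and the concrete block product. -/

section Forms

variable {p q : ℕ}

/-- The bilinear map `(u, c) ↦ (u¹ c, …, u^p c)`. -/
def blockProd (p q : ℕ) : EuclideanSpace ℝ (Fin p) →L[ℝ] EuclideanSpace ℝ (Fin q) →L[ℝ]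
    EuclideanSpace ℝ (Fin (p * q)) :=
  LinearMap.toContinuousLinearMap
    ((LinearMap.toContinuousLinearMap : _ ≃ₗ[ℝ] _).toLinearMap ∘ₗ LinearMap.mk₂ ℝ
      (fun u c => WithLp.toLp 2 fun a => u (finProdFinEquiv.symm a).1 * c (finProdFinEquiv.symm a).2)
      (fun _ _ _ => by ext; simp [add_mul]) (fun _ _ _ => by ext; simp [mul_assoc])
      (fun _ _ _ => by ext; simp [mul_add]) (fun _ _ _ => by ext; simp [mul_left_comm]))

lemma blockProd_apply (u : EuclideanSpace ℝ (Fin p)) (c : EuclideanSpace ℝ (Fin q)) (a) :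
    blockProd p q u c a = u (finProdFinEquiv.symm a).1 * c (finProdFinEquiv.symm a).2 := rfl

lemma inner_blockProd (u v : EuclideanSpace ℝ (Fin p)) (c d : EuclideanSpace ℝ (Fin q)) :
    ⟪blockProd p q u c, blockProd p q v d⟫ = ⟪u, v⟫ * ⟪c, d⟫ := by
  simp only [PiLp.inner_apply, blockProd_apply, Finset.sum_mul_sum, ← Finset.sum_product']
  rw [Finset.univ_product_univ, ← finProdFinEquiv.symm.sum_comp]
  refine Finset.sum_congr rfl fun a _ => ?_
  simp
  ring

lemma blockForm_eq (G : EuclideanSpace ℝ (Fin p) → EuclideanSpace ℝ (Fin q))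
    (x : EuclideanSpace ℝ (Fin p)) : blockForm G x = blockProd p q x (G x) := rfl

variable {k : ℕ} {G : EuclideanSpace ℝ (Fin p) → EuclideanSpace ℝ (Fin q)}

lemma IsForm.map_smul (hG : IsForm k G) (t : ℝ) (x : EuclideanSpace ℝ (Fin p)) :
    G (t • x) = t ^ k • G x := by
  ext j
  obtain ⟨P, hP, hPG⟩ := hG j
  rw [PiLp.smul_apply, hPG, hPG, smul_eq_mul, WithLp.ofLp_smul, MvPolynomial.eval_eq,
    MvPolynomial.eval_eq, Finset.mul_sum]
  refine Finset.sum_congr rfl fun d hd => ?_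
  have hk : ∑ i ∈ d.support, d i = k := by
    rw [← hP (MvPolynomial.mem_support_iff.1 hd), Finsupp.weight_apply]
    simp [Finsupp.sum]
  simp only [Pi.smul_apply, smul_eq_mul, mul_pow, Finset.prod_mul_distrib,
    Finset.prod_pow_eq_pow_sum, hk]
  ring

lemma IsForm.contDiff (hG : IsForm k G) {n : ℕ∞ω} : ContDiff ℝ n G := by
  refine contDiff_euclidean.2 fun j => ?_
  obtain ⟨P, -, hPG⟩ := hG j
  simp only [hPG]
  have h : ContDiff ℝ n fun x : Fin p → ℝ => MvPolynomial.eval x P :=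
    (AnalyticOnNhd.eval_mvPolynomial P).contDiff
  exact h.comp (PiLp.contDiff_ofLp)

lemma IsForm.blockForm (hG : IsForm k G) : IsForm (k + 1) (blockForm G) := by
  intro a
  obtain ⟨P, hP, hPG⟩ := hG (finProdFinEquiv.symm a).2
  refine ⟨MvPolynomial.X (finProdFinEquiv.symm a).1 * P, ?_, fun x => ?_⟩
  · rw [add_comm]
    exact (MvPolynomial.isHomogeneous_X ℝ _).mul hP
  · rw [map_mul, MvPolynomial.eval_X, ← hPG]
    rfl

lemma mapsTo_blockForm (hG : Set.MapsTo G (Metric.sphere 0 1) (Metric.sphere 0 1)) :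
    Set.MapsTo (blockForm G) (Metric.sphere 0 1) (Metric.sphere 0 1) := by
  intro x hx
  have hGx := hG hx
  rw [mem_sphere_zero_iff_norm] at hx hGx ⊢
  have h := inner_blockProd x x (G x) (G x)
  rw [real_inner_self_eq_norm_sq, real_inner_self_eq_norm_sq, real_inner_self_eq_norm_sq, hx, hGx,
    ← blockForm_eq, one_pow, one_mul] at h
  exact (pow_eq_one_iff_of_nonneg (norm_nonneg _) two_ne_zero).1 h

end Forms

end SphereMap

end

/-! ### The main theorem. -/

open SphereMap Laplacian in
theorem mainTheorem4 (m n k : ℕ)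
    (G : EuclideanSpace ℝ (Fin (m + 1)) → EuclideanSpace ℝ (Fin (n + 1)))
    (hG : SphereMap.IsHarmonicForm k G)
    (hmaps : Set.MapsTo G (Metric.sphere 0 1) (Metric.sphere 0 1))
    (hnonconst : ¬ ∃ c, ∀ x, hmaps.restrict G (Metric.sphere 0 1) (Metric.sphere 0 1) x = c) :
    SphereMap.IsForm (k + 1) (SphereMap.blockForm G) ∧
    ∃ hF : Set.MapsTo (SphereMap.blockForm G) (Metric.sphere 0 1) (Metric.sphere 0 1),
      (SphereMap.IsProperBiharmonicMap
          (hF.restrict (SphereMap.blockForm G) (Metric.sphere 0 1) (Metric.sphere 0 1)) ↔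
        m = 1) := by
  obtain ⟨hform, hharm⟩ := hG
  have hF := mapsTo_blockForm hmaps
  refine ⟨hform.blockForm, hF, ?_⟩
  set φ := hF.restrict (blockForm G) (Metric.sphere 0 1) (Metric.sphere 0 1)
  have hG3 : ContDiff ℝ 3 G := hform.contDiff
  have hΔ : Δ G = 0 := funext fun x => (hharm x (Set.mem_univ x)).2.self_of_nhds
  have hE : ∀ x, fderiv ℝ G x x = (k : ℝ) • G x :=
    fderiv_self_of_homogeneous (hG3.differentiable (by norm_num)) hform.map_smul
  have hφ : Extends (fun y => blockProd (m + 1) (n + 1) y (G y)) φ := fun _ => rfl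
  have hm : Module.finrank ℝ (EuclideanSpace ℝ (Fin (m + 1))) = m + 1 := finrank_euclideanSpace_fin
  have : Fact (Module.finrank ℝ (EuclideanSpace ℝ (Fin (m + 1))) = m + 1) := ⟨hm⟩
  have hsmooth : IsSmooth φ :=
    hform.blockForm.contDiff.contMDiff.comp contMDiff_coe_sphere
  -- This is where nonconstancy of the restriction enters: a form of degree `0` equals `G 0`
  -- everywhere.
  have hk : k ≠ 0 := by
    rintro rfl
    have hc : ∀ x, G x = G 0 := fun x => by
      have h := hform.map_smul 0 x
      rw [zero_smul, pow_zero, one_smul] at h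
      exact h.symm
    let x₀ : Metric.sphere (0 : EuclideanSpace ℝ (Fin (m + 1))) 1 :=
      ⟨EuclideanSpace.single 0 1, by simp⟩
    exact hnonconst ⟨hmaps.restrict G _ _ x₀, fun x =>
      Subtype.ext ((hc x).trans (hc x₀).symm)⟩
  have hτ₂ := bitensionField_bilinear inner_blockProd hG3 hE hφ hm hΔ
  constructor
  · rintro ⟨⟨-, hbi⟩, hnot⟩
    by_contra hm1
    refine hnot ⟨hsmooth, fun x => ?_⟩
    have h := hτ₂ x
    rw [hbi x] at h
    -- The factor `2(m - 1)` is nonzero for every `m ≠ 1`, including `m = 0`.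
    refine (smul_eq_zero.1 h.symm).resolve_left fun h0 => hm1 ?_
    have h1 : (m : ℝ) = 1 := by linarith
    exact_mod_cast h1
  · rintro rfl
    refine ⟨⟨hsmooth, fun x => by simp [hτ₂ x]⟩, fun hh => hk ?_⟩
    exact degree_eq_zero_of_tensionField_eq_zero inner_blockProd hG3 hE hφ hm hΔ hh.2
      ⟨EuclideanSpace.single 0 1, by simp⟩
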